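/- Let $d \ge 1$ be an integer. For $m \ge 1$ let $\tilde{F}_d(m)$ denote the number of primitive Dirichlet characters (even or odd, with values in $\mathbb{C}$) of conductor $m$ and order dividing $d$, and let $$L_d(s) := \sum_{m=1}^\infty \tilde{F}_d(m)\, m^{-s}.$$ Then the Dirichlet series $L_d(s)$ converges absolutely for every $s \in \mathbb{C}$ with $\Re(s) > 1$. Moreover, the function it defines on $\Re(s)>1$ extends to a meromorphic function on the half plane $\Re(s) > 1/2$, and this extension has a pole of order exactly $\tau(d)-1$ at $s=1$, where $\tau(d)$ is the number of positive divisors of $d$. (For $d=1$, a pole of order $0$ means that the extension has order $0$ at $s=1$, i.e. neither a zero nor a pole there.) -/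

import Mathlib

/-- The number of primitive (complex) Dirichlet characters of conductor `m` whose order
divides `d`.  A character of level `m` is primitive exactly when its conductor is `m`. -/
noncomputable def numPrimitiveCharOrderDvd (d m : ℕ) : ℕ :=
  Nat.card {χ : DirichletCharacter ℂ m // χ.IsPrimitive ∧ orderOf χ ∣ d}

/-- The coefficients `m ↦ numPrimitiveCharOrderDvd d m` of the Dirichlet series `L_d(s)`. -/
noncomputable def charCountCoeff (d : ℕ) : ℕ → ℂ :=
  fun m => (numPrimitiveCharOrderDvd d m : ℂ)

/-!
Write `f m` for the number of primitive characters of conductor `m` and order dividing `d`. Every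
character modulo `m` is induced by a unique primitive one, so `∑ c ∣ m, f c` counts the characters
`χ` modulo `m` with `χ ^ d = 1`; their number is that of the `d`-torsion of `(ℤ/m)ˣ`. This count is
multiplicative by the Chinese remainder theorem, hence so is `f`
(`exists_isMultiplicative_numPrimitiveCharOrderDvd`), and the Dirichlet series of `f` has an Euler
product.

At a prime `p`, cyclicity of `(ℤ/p)ˣ` and the orthogonality relations give
`f p = ∑ χ p`, the sum being over all characters `χ` modulo `e`, for all divisors `e ≠ 1` of `d`
(`numPrimitiveCharOrderDvd_prime`). At higher prime powers, `f (p ^ k)` is bounded uniformly in `p`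
and `k`, and vanishes for `k ≥ 2 * d + 2` because residues congruent to `1` modulo `p ^ (k - 1)` are
`d`-th powers modulo `p ^ k` (`numPrimitiveCharOrderDvd_prime_pow_eq_zero`). The bounds give
absolute convergence for `1 < re s`.

Multiplying the Euler factor at `p` by `∏ (1 - χ p * p ^ (-s))` over these same `χ` cancels the term
of first order in `p ^ (-s)`, so that what remains is `1 + O(p ^ (-2 * re s))`
(`exists_norm_charCountCorrection_sub_one_le`). The product `H` of these corrected factors is
therefore holomorphic on `1 / 2 < re s`, and `H 1 ≠ 0` since no factor vanishes at `1`. Thus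
`H s * ∏ L(χ, s)` is the required continuation. Each trivial character among the `χ` contributes a
simple pole at `1`, and there is one of these for each divisor `e ≠ 1` of `d`; the other
`L`-functions are finite and nonzero at `1`, so the pole has order `τ(d) - 1`.
-/

open Finset

/-! ### Counting primitive characters of bounded order -/

lemma sum_divisors_numPrimitiveCharOrderDvd (d : ℕ) {m : ℕ} (hm : m ≠ 0) :
    ∑ c ∈ m.divisors, numPrimitiveCharOrderDvd d c =
      Nat.card {χ : DirichletCharacter ℂ m // χ ^ d = 1} := by
  have : NeZero m := ⟨hm⟩
  rw [← Finset.sum_coe_sort]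
  simp only [numPrimitiveCharOrderDvd]
  rw [← Nat.card_sigma]
  let F : (Σ c : m.divisors, {χ : DirichletCharacter ℂ c // χ.IsPrimitive ∧ orderOf χ ∣ d}) →
      {χ : DirichletCharacter ℂ m // χ ^ d = 1} := fun x =>
    ⟨DirichletCharacter.changeLevel (Nat.dvd_of_mem_divisors x.1.2) x.2.1, by
      rw [← map_pow, orderOf_dvd_iff_pow_eq_one.1 x.2.2.2, map_one]⟩
  refine Nat.card_congr (Equiv.ofBijective F ⟨?_, ?_⟩)
  · rintro ⟨⟨c, hc⟩, χ, hχ, hχ'⟩ ⟨⟨c', hc'⟩, ψ, hψ, hψ'⟩ h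
    have h' := congrArg Subtype.val h
    simp only [F] at h'
    have hcc := congrArg DirichletCharacter.conductor h'
    rw [DirichletCharacter.conductor_changeLevel, DirichletCharacter.conductor_changeLevel,
      (DirichletCharacter.isPrimitive_def _).1 hχ,
      (DirichletCharacter.isPrimitive_def _).1 hψ] at hcc
    subst hcc
    obtain rfl := DirichletCharacter.changeLevel_injective _ h'
    rfl
  · rintro ⟨χ, hχ⟩
    refine ⟨⟨⟨χ.conductor, Nat.mem_divisors.2 ⟨χ.conductor_dvd_level, hm⟩⟩,
      χ.primitiveCharacter, χ.primitiveCharacter_isPrimitive, ?_⟩, ?_⟩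
    · rw [orderOf_dvd_iff_pow_eq_one]
      apply DirichletCharacter.changeLevel_injective χ.conductor_dvd_level
      rw [map_pow, χ.changeLevel_primitiveCharacter, hχ, map_one]
    · exact Subtype.ext χ.changeLevel_primitiveCharacter

lemma card_dirichletCharacter_pow_eq_one (d m : ℕ) [NeZero m] :
    Nat.card {χ : DirichletCharacter ℂ m // χ ^ d = 1} =
      Nat.card {u : (ZMod m)ˣ // u ^ d = 1} := by
  obtain ⟨E⟩ := DirichletCharacter.mulEquiv_units ℂ m
  exact Nat.card_congr (E.toEquiv.subtypeEquiv fun χ => by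
    change _ ↔ E χ ^ d = 1
    rw [← map_pow, EmbeddingLike.map_eq_one_iff])

lemma card_units_pow_eq_one_mul (d : ℕ) {m n : ℕ} (h : m.Coprime n) :
    Nat.card {u : (ZMod (m * n))ˣ // u ^ d = 1} =
      Nat.card {u : (ZMod m)ˣ // u ^ d = 1} * Nat.card {u : (ZMod n)ˣ // u ^ d = 1} := by
  rw [← Nat.card_prod]
  let E : (ZMod (m * n))ˣ ≃* (ZMod m)ˣ × (ZMod n)ˣ :=
    (Units.mapEquiv (ZMod.chineseRemainder h).toMulEquiv).trans MulEquiv.prodUnits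
  refine Nat.card_congr ((E.toEquiv.subtypeEquiv (q := fun u => u.1 ^ d = 1 ∧ u.2 ^ d = 1)
    fun u => ?_).trans ((Equiv.subtypeProdEquivProd (p := fun u : (ZMod m)ˣ => u ^ d = 1)
    (q := fun u : (ZMod n)ˣ => u ^ d = 1))))
  change _ ↔ (E u).1 ^ d = 1 ∧ (E u).2 ^ d = 1
  rw [← Prod.pow_fst, ← Prod.pow_snd, ← map_pow, ← E.map_eq_one_iff, Prod.ext_iff]
  rfl

open ArithmeticFunction in
/-- Every character modulo `m` comes from a unique primitive character of conductor dividing `m`,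
so the count of primitive characters is the Möbius inverse of the count of all characters. The
latter is multiplicative by the Chinese remainder theorem. -/
lemma exists_isMultiplicative_numPrimitiveCharOrderDvd (d : ℕ) :
    ∃ f : ArithmeticFunction ℤ, f.IsMultiplicative ∧
      ∀ m, m ≠ 0 → f m = numPrimitiveCharOrderDvd d m := by
  let f : ArithmeticFunction ℤ :=
    ⟨fun m => if m = 0 then 0 else (numPrimitiveCharOrderDvd d m : ℤ), by simp⟩
  let g : ArithmeticFunction ℤ :=
    ⟨fun m => if m = 0 then 0 else (Nat.card {u : (ZMod m)ˣ // u ^ d = 1} : ℤ), by simp⟩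
  have hg : g.IsMultiplicative := by
    rw [IsMultiplicative.iff_ne_zero]
    refine ⟨?_, fun {m n} hm hn h => ?_⟩
    · have : Subsingleton (ZMod 1)ˣ := inferInstance
      simp only [g, coe_mk, one_ne_zero, if_false]
      norm_cast
      rw [Nat.card_eq_one_iff_unique]
      exact ⟨inferInstance, ⟨⟨1, one_pow _⟩⟩⟩
    · simp [g, coe_mk, hm, hn, card_units_pow_eq_one_mul d h]
  have hfg : (zeta : ArithmeticFunction ℤ) * f = g := by
    ext m
    rw [coe_zeta_mul_apply]
    rcases eq_or_ne m 0 with rfl | hm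
    · simp
    have : NeZero m := ⟨hm⟩
    simp only [g, coe_mk, hm, if_false]
    rw [← card_dirichletCharacter_pow_eq_one, ← sum_divisors_numPrimitiveCharOrderDvd d hm]
    push_cast
    refine Finset.sum_congr rfl fun c hc => ?_
    simp [f, (Nat.pos_of_mem_divisors hc).ne']
  refine ⟨f, ?_, fun m hm => by simp [f, hm]⟩
  have : f = moebius * g := by
    rw [← hfg, ← mul_assoc, moebius_mul_coe_zeta, one_mul]
  rw [this]
  exact isMultiplicative_moebius.mul hg

lemma numPrimitiveCharOrderDvd_one (d : ℕ) : numPrimitiveCharOrderDvd d 1 = 1 := by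
  obtain ⟨f, hf, h⟩ := exists_isMultiplicative_numPrimitiveCharOrderDvd d
  have := h 1 one_ne_zero
  rw [hf.map_one] at this
  exact_mod_cast this.symm

lemma numPrimitiveCharOrderDvd_mul (d : ℕ) {m n : ℕ} (hm : m ≠ 0) (hn : n ≠ 0)
    (hmn : m.Coprime n) : numPrimitiveCharOrderDvd d (m * n) =
      numPrimitiveCharOrderDvd d m * numPrimitiveCharOrderDvd d n := by
  obtain ⟨f, hf, h⟩ := exists_isMultiplicative_numPrimitiveCharOrderDvd d
  have := hf.map_mul_of_coprime hmn
  rw [h _ hm, h _ hn, h _ (mul_ne_zero hm hn)] at this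
  exact_mod_cast this

lemma numPrimitiveCharOrderDvd_le (d : ℕ) {m : ℕ} (hm : m ≠ 0) :
    numPrimitiveCharOrderDvd d m ≤ m := by
  have : NeZero m := ⟨hm⟩
  calc numPrimitiveCharOrderDvd d m ≤ Nat.card (DirichletCharacter ℂ m) :=
        Nat.card_le_card_of_injective _ Subtype.val_injective
    _ = m.totient := DirichletCharacter.card_eq_totient_of_hasEnoughRootsOfUnity ℂ m
    _ ≤ m := m.totient_le

/-- The number of primitive characters of prime conductor `p` and order dividing `d`, expressed by
the orthogonality relations as a sum of values of Dirichlet characters at `p`. -/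
lemma numPrimitiveCharOrderDvd_prime {d : ℕ} (hd : d ≠ 0) {p : ℕ} (hp : p.Prime) :
    (numPrimitiveCharOrderDvd d p : ℂ) =
      ∑ e : {e // e ∈ d.divisors.erase 1}, ∑ χ : DirichletCharacter ℂ e, χ p := by
  have : Fact p.Prime := ⟨hp⟩
  have h1 : numPrimitiveCharOrderDvd d p + 1 = Nat.card {u : (ZMod p)ˣ // u ^ d = 1} := by
    rw [← card_dirichletCharacter_pow_eq_one, ← sum_divisors_numPrimitiveCharOrderDvd d hp.ne_zero,
      hp.sum_divisors, numPrimitiveCharOrderDvd_one]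
  have h2 : Nat.card {u : (ZMod p)ˣ // u ^ d = 1} =
      ∑ e ∈ d.divisors, if (p : ZMod e) = 1 then e.totient else 0 := by
    classical
    rw [Nat.card_eq_fintype_card, Fintype.card_subtype,
      Finset.card_eq_sum_card_fiberwise (f := fun u => orderOf u) (t := d.divisors)]
    · refine Finset.sum_congr rfl fun e he => ?_
      have hed := Nat.dvd_of_mem_divisors he
      rw [Finset.filter_filter]
      have : (Finset.univ.filter fun u : (ZMod p)ˣ => u ^ d = 1 ∧ orderOf u = e) =
          Finset.univ.filter fun u : (ZMod p)ˣ => orderOf u = e := by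
        refine Finset.filter_congr fun u _ => ⟨fun h => h.2, fun h => ⟨?_, h⟩⟩
        rw [← orderOf_dvd_iff_pow_eq_one, h]
        exact hed
      rw [this]
      have hiff : (p : ZMod e) = 1 ↔ e ∣ p - 1 := by
        rw [← Nat.cast_one, eq_comm, ZMod.natCast_eq_natCast_iff, Nat.modEq_iff_dvd' hp.one_le]
      split_ifs with h
      · exact IsCyclic.card_orderOf_eq_totient (by rw [ZMod.card_units]; exact hiff.1 h)
      · rw [Finset.card_eq_zero, Finset.filter_eq_empty_iff]
        rintro u - rfl
        exact h (hiff.2 (by rw [← ZMod.card_units p]; exact orderOf_dvd_card))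
    · intro u hu
      simp only [Finset.coe_filter, Finset.mem_univ, true_and, Set.mem_ofPred_eq] at hu
      simpa [hd] using orderOf_dvd_of_pow_eq_one hu
  have h3 : (1 : ℕ) ∈ d.divisors := by simp [hd]
  rw [h2, ← Finset.add_sum_erase _ _ h3, if_pos (Subsingleton.elim _ _), Nat.totient_one,
    add_comm, add_left_cancel_iff] at h1
  rw [h1, Finset.sum_coe_sort (d.divisors.erase 1)
    (fun e : ℕ => ∑ χ : DirichletCharacter ℂ e, χ (p : ZMod e))]
  push_cast
  refine Finset.sum_congr rfl fun e he => ?_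
  have : NeZero e := ⟨(Nat.pos_of_mem_divisors (Finset.mem_of_mem_erase he)).ne'⟩
  rw [DirichletCharacter.sum_characters_eq]

lemma numPrimitiveCharOrderDvd_prime_le {d : ℕ} (hd : d ≠ 0) {p : ℕ} (hp : p.Prime) :
    numPrimitiveCharOrderDvd d p ≤ d := by
  classical
  have : Fact p.Prime := ⟨hp⟩
  calc numPrimitiveCharOrderDvd d p ≤ ∑ c ∈ p.divisors, numPrimitiveCharOrderDvd d c :=
        Finset.single_le_sum (f := fun c => numPrimitiveCharOrderDvd d c)
          (fun _ _ => Nat.zero_le _) (by simp [hp.ne_zero])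
    _ = Nat.card {u : (ZMod p)ˣ // u ^ d = 1} := by
        rw [sum_divisors_numPrimitiveCharOrderDvd d hp.ne_zero, card_dirichletCharacter_pow_eq_one]
    _ ≤ d := by
        rw [Nat.card_eq_fintype_card, Fintype.card_subtype]
        exact IsCyclic.card_pow_eq_one_le (Nat.pos_of_ne_zero hd)

lemma one_add_pow_of_sq_eq_zero {R : Type*} [CommRing R] {x : R} (hx : x ^ 2 = 0) (n : ℕ) :
    (1 + x) ^ n = 1 + n * x := by
  induction n with
  | zero => simp
  | succ n ih =>
    rw [pow_succ, ih]
    push_cast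
    linear_combination (n : R) * hx

/-- If `v` is the exponent of `p` in `d` and `k ≥ 2v + 2`, every residue class modulo `p ^ k`
congruent to `1` modulo `p ^ (k - 1)` is a `d`-th power, so a character modulo `p ^ k` of order
dividing `d` is already defined modulo `p ^ (k - 1)`. -/
lemma numPrimitiveCharOrderDvd_prime_pow_eq_zero {d : ℕ} (hd : d ≠ 0) {p : ℕ} (hp : p.Prime)
    {k : ℕ} (hk : 2 * d.factorization p + 2 ≤ k) : numPrimitiveCharOrderDvd d (p ^ k) = 0 := by
  have : NeZero (p ^ k) := ⟨pow_ne_zero _ hp.ne_zero⟩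
  have hdvd : p ^ (k - 1) ∣ p ^ k := pow_dvd_pow p (Nat.sub_le _ _)
  rw [numPrimitiveCharOrderDvd]
  have : IsEmpty {χ : DirichletCharacter ℂ (p ^ k) // χ.IsPrimitive ∧ orderOf χ ∣ d} := by
    refine ⟨fun ⟨χ, hprim, hord⟩ => ?_⟩
    have hfac : χ.FactorsThrough (p ^ (k - 1)) := by
      rw [DirichletCharacter.factorsThrough_iff_ker_unitsMap hdvd]
      intro u hu
      set v := d.factorization p with hv
      obtain ⟨d', hd'⟩ : ∃ d', d = p ^ v * d' := Nat.ordProj_dvd d p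
      have hpd' : d'.Coprime p := by
        have h := Nat.coprime_ordCompl hp hd
        rw [← hv, Nat.div_eq_of_eq_mul_right (pow_pos hp.pos v) hd'] at h
        exact h.symm
      obtain ⟨w, hw⟩ : IsUnit (d' : ZMod (p ^ k)) :=
        (ZMod.isUnit_iff_coprime _ _).2 (hpd'.pow_right k)
      obtain ⟨a, ha⟩ : ∃ a : ZMod (p ^ k),
          (u : ZMod (p ^ k)) = 1 + (p : ZMod (p ^ k)) ^ (k - 1) * a := by
        have h1 : ((u : ZMod (p ^ k)).val : ZMod (p ^ (k - 1))) = 1 := by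
          have := congrArg Units.val (MonoidHom.mem_ker.1 hu)
          rwa [ZMod.unitsMap_val, ← ZMod.natCast_val, Units.val_one] at this
        have h2 : ((p ^ (k - 1) : ℕ) : ℤ) ∣ ((u : ZMod (p ^ k)).val : ℤ) - 1 := by
          rw [← ZMod.intCast_zmod_eq_zero_iff_dvd]
          push_cast
          rw [h1, sub_self]
        obtain ⟨a, ha⟩ := h2
        refine ⟨(a : ZMod (p ^ k)), ?_⟩
        have := congrArg (Int.cast : ℤ → ZMod (p ^ k)) ha
        push_cast at this
        rw [ZMod.natCast_zmod_val] at this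
        linear_combination this
      -- The square of `x` vanishes since `2 * (k - 1 - v) ≥ k`, and `d * x = p ^ (k - 1) * a`, so
      -- `1 + x` is a `d`-th root of `u`.
      set x : ZMod (p ^ k) := (p : ZMod (p ^ k)) ^ (k - 1 - v) *
        (a * ((w⁻¹ : (ZMod (p ^ k))ˣ) : ZMod (p ^ k))) with hx
      have hpk : (p : ZMod (p ^ k)) ^ k = 0 := by
        rw [← Nat.cast_pow, ZMod.natCast_self]
      have hx2 : x ^ 2 = 0 := by
        rw [hx, mul_pow, ← pow_mul, pow_eq_zero_of_le (by omega) hpk, zero_mul]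
      have hpow : (1 + x) ^ d = u := by
        rw [one_add_pow_of_sq_eq_zero hx2, ha, hx]
        nth_rewrite 1 [hd']
        push_cast
        rw [← hw]
        have e1 : (p : ZMod (p ^ k)) ^ (k - 1) =
            (p : ZMod (p ^ k)) ^ v * (p : ZMod (p ^ k)) ^ (k - 1 - v) := by
          rw [← pow_add]; congr 1; omega
        rw [e1]
        linear_combination
          (p : ZMod (p ^ k)) ^ v * (p : ZMod (p ^ k)) ^ (k - 1 - v) * a * w.mul_inv
      have hunit : IsUnit (1 + x) := (isUnit_pow_iff hd).1 (hpow ▸ u.isUnit)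
      rw [MonoidHom.mem_ker, Units.ext_iff, MulChar.coe_toUnitHom, Units.val_one, ← hpow, map_pow,
        ← MulChar.pow_apply' χ hd, orderOf_dvd_iff_pow_eq_one.1 hord, MulChar.one_apply hunit]
    have h1 : χ.conductor ∣ p ^ (k - 1) :=
      DirichletCharacter.conductor_dvd_of_mem_conductorSet χ hfac
    rw [(DirichletCharacter.isPrimitive_def _).1 hprim] at h1
    have := (Nat.pow_dvd_pow_iff_le_right hp.one_lt).1 h1
    omega
  exact Nat.card_of_isEmpty

lemma numPrimitiveCharOrderDvd_prime_pow_eq_zero_of_le {d : ℕ} (hd : d ≠ 0) {p : ℕ} (hp : p.Prime)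
    {k : ℕ} (hk : 2 * d + 2 ≤ k) : numPrimitiveCharOrderDvd d (p ^ k) = 0 :=
  numPrimitiveCharOrderDvd_prime_pow_eq_zero hd hp
    (by have := (Nat.factorization_lt p hd).le; omega)

/-- The bound is uniform in `p` and `k`: for `p ∣ d` only exponents `k < 2 * d + 2` matter, and for
`p ∤ d` only `k ≤ 1`. -/
lemma numPrimitiveCharOrderDvd_prime_pow_le {d : ℕ} (hd : d ≠ 0) {p : ℕ} (hp : p.Prime) (k : ℕ) :
    numPrimitiveCharOrderDvd d (p ^ k) ≤ d ^ (2 * d + 2) := by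
  have hd1 : 1 ≤ d := Nat.pos_of_ne_zero hd
  rcases le_or_gt (2 * d + 2) k with hk | hk
  · simp [numPrimitiveCharOrderDvd_prime_pow_eq_zero_of_le hd hp hk]
  by_cases hpd : p ∣ d
  · calc _ ≤ p ^ k := numPrimitiveCharOrderDvd_le d (pow_ne_zero _ hp.ne_zero)
      _ ≤ d ^ k := Nat.pow_le_pow_left (Nat.le_of_dvd hd1 hpd) k
      _ ≤ d ^ (2 * d + 2) := Nat.pow_le_pow_right hd1 hk.le
  · rcases lt_or_ge k 2 with h | h
    · interval_cases k
      · simpa [numPrimitiveCharOrderDvd_one] using Nat.one_le_pow _ _ hd1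
      · rw [pow_one]
        exact (numPrimitiveCharOrderDvd_prime_le hd hp).trans (Nat.le_self_pow (by omega) d)
    · rw [numPrimitiveCharOrderDvd_prime_pow_eq_zero hd hp
        (by rw [Nat.factorization_eq_zero_of_not_dvd hpd]; omega)]
      exact Nat.zero_le _

/-! ### Summability from prime powers -/

/-- A multiplicative function is absolutely summable as soon as its values at the nontrivial prime
powers are: a partial sum up to `N` is at most the sum over `N`-smooth numbers, which is a finite
Euler product, and `∏ (1 + t p) ≤ exp (∑ t p)`. -/
lemma summable_norm_of_summable_prime_pow {a : ℕ → ℂ} (h0 : a 0 = 0) (h1 : a 1 = 1)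
    (hmul : ∀ {m n}, Nat.Coprime m n → a (m * n) = a m * a n)
    (hp : ∀ {p : ℕ}, p.Prime → Summable fun k => ‖a (p ^ k)‖)
    (hsum : Summable fun p : Nat.Primes => ∑' k, ‖a ((p : ℕ) ^ (k + 1))‖) :
    Summable fun n => ‖a n‖ := by
  have hmain (N : ℕ) := EulerProduct.summable_and_hasSum_smoothNumbers_prod_primesBelow_tsum
    (f := fun n => ‖a n‖) (by simp [h1]) (fun h => by simp [hmul h])
    (fun h => by simpa using hp h) N
  refine summable_of_sum_range_le
    (c := Real.exp (∑' p : Nat.Primes, ∑' k, ‖a ((p : ℕ) ^ (k + 1))‖))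
    (fun _ => norm_nonneg _) fun N => ?_
  have hS := (hmain N).2.summable
  calc ∑ n ∈ range N, ‖a n‖ = ∑ n ∈ (range N).filter (· ∈ N.smoothNumbers), ‖a n‖ := by
        refine (Finset.sum_filter_of_ne fun n hn hne => ?_).symm
        have hn0 : n ≠ 0 := by rintro rfl; simp [h0] at hne
        exact Nat.mem_smoothNumbers_of_lt (Nat.pos_of_ne_zero hn0) (Finset.mem_range.1 hn)
    _ ≤ ∑' n : N.smoothNumbers, ‖a n‖ := by
        classical
        rw [← Finset.sum_subtype_eq_sum_filter]
        exact (hS.sum_le_tsum _ fun _ _ => norm_nonneg _)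
    _ = ∏ p ∈ N.primesBelow, ∑' k, ‖a (p ^ k)‖ := (hmain N).2.tsum_eq
    _ ≤ ∏ p ∈ N.primesBelow, Real.exp (∑' k, ‖a (p ^ (k + 1))‖) := by
        refine Finset.prod_le_prod (fun _ _ => tsum_nonneg fun _ => norm_nonneg _) fun p hpN => ?_
        rw [(hp (Nat.prime_of_mem_primesBelow hpN)).tsum_eq_zero_add, pow_zero, h1, norm_one,
          add_comm]
        exact Real.add_one_le_exp _
    _ = Real.exp (∑ p ∈ N.primesBelow, ∑' k, ‖a (p ^ (k + 1))‖) := (Real.exp_sum _ _).symm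
    _ ≤ _ := by
        refine Real.exp_le_exp.2 ?_
        have : ∑ p ∈ N.primesBelow, ∑' k, ‖a (p ^ (k + 1))‖ =
            ∑ p ∈ N.primesBelow.subtype Nat.Prime, ∑' k, ‖a ((p : ℕ) ^ (k + 1))‖ := by
          rw [Finset.sum_subtype_of_mem (fun p => ∑' k, ‖a (p ^ (k + 1))‖)
            fun p h => Nat.prime_of_mem_primesBelow h]
        rw [this]
        exact hsum.sum_le_tsum (ι := Nat.Primes) (N.primesBelow.subtype Nat.Prime)
          fun _ _ => tsum_nonneg fun _ => norm_nonneg _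

lemma norm_prime_cpow_neg {p : ℕ} (hp : p.Prime) (s : ℂ) :
    ‖(p : ℂ) ^ (-s)‖ = (p : ℝ) ^ (-s.re) := by
  rw [Complex.norm_natCast_cpow_of_pos hp.pos, Complex.neg_re]

lemma norm_prime_cpow_neg_lt_one {p : ℕ} (hp : p.Prime) {s : ℂ} (hs : 0 < s.re) :
    ‖(p : ℂ) ^ (-s)‖ < 1 := by
  rw [norm_prime_cpow_neg hp]
  exact Real.rpow_lt_one_of_one_lt_of_neg (by exact_mod_cast hp.one_lt) (by linarith)

/-! ### The Euler product of the counting series -/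

lemma term_charCountCoeff_mul (d : ℕ) (s : ℂ) {m n : ℕ} (h : m.Coprime n) :
    LSeries.term (charCountCoeff d) s (m * n) =
      LSeries.term (charCountCoeff d) s m * LSeries.term (charCountCoeff d) s n := by
  rcases eq_or_ne m 0 with rfl | hm
  · simp
  rcases eq_or_ne n 0 with rfl | hn
  · simp
  rw [LSeries.term_of_ne_zero hm, LSeries.term_of_ne_zero hn,
    LSeries.term_of_ne_zero (mul_ne_zero hm hn), charCountCoeff, charCountCoeff, charCountCoeff,
    numPrimitiveCharOrderDvd_mul d hm hn h, Nat.cast_mul, Nat.cast_mul,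
    Complex.natCast_mul_natCast_cpow, mul_div_mul_comm]

lemma term_charCountCoeff_one (d : ℕ) (s : ℂ) : LSeries.term (charCountCoeff d) s 1 = 1 := by
  simp [LSeries.term_of_ne_zero, charCountCoeff, numPrimitiveCharOrderDvd_one]

lemma term_charCountCoeff_prime_pow (d : ℕ) (s : ℂ) {p : ℕ} (hp : p.Prime) (k : ℕ) :
    LSeries.term (charCountCoeff d) s (p ^ k) =
      numPrimitiveCharOrderDvd d (p ^ k) * ((p : ℂ) ^ (-s)) ^ k := by
  rw [LSeries.term_of_ne_zero (pow_ne_zero _ hp.ne_zero), charCountCoeff, div_eq_mul_inv,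
    ← Complex.cpow_neg, Nat.cast_pow, ← Complex.natCast_cpow_natCast_mul, mul_comm (k : ℂ),
    Complex.cpow_mul_nat]

/-- The Euler factor at `p` of the Dirichlet series `∑ charCountCoeff d m * m ^ (-s)`; the
coefficients of the omitted powers vanish. -/
noncomputable def charCountEulerFactor (d p : ℕ) (s : ℂ) : ℂ :=
  ∑ k ∈ range (2 * d + 2), numPrimitiveCharOrderDvd d (p ^ k) * ((p : ℂ) ^ (-s)) ^ k

lemma hasSum_charCountEulerFactor {d : ℕ} (hd : d ≠ 0) (s : ℂ) {p : ℕ} (hp : p.Prime) :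
    HasSum (fun k => LSeries.term (charCountCoeff d) s (p ^ k)) (charCountEulerFactor d p s) := by
  simp only [term_charCountCoeff_prime_pow d s hp]
  refine hasSum_sum_of_ne_finset_zero fun k hk => ?_
  rw [numPrimitiveCharOrderDvd_prime_pow_eq_zero_of_le hd hp (by simpa using hk), Nat.cast_zero,
    zero_mul]

lemma summable_norm_term_charCountCoeff {d : ℕ} (hd : d ≠ 0) {s : ℂ} (hs : 1 < s.re) :
    Summable fun n => ‖LSeries.term (charCountCoeff d) s n‖ := by
  refine summable_norm_of_summable_prime_pow (by simp) (term_charCountCoeff_one d s)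
    (term_charCountCoeff_mul d s) (fun hp => (hasSum_charCountEulerFactor hd s hp).summable.norm) ?_
  have hP : Summable fun p : Nat.Primes => (p : ℝ) ^ (-s.re) :=
    Nat.Primes.summable_rpow.2 (by linarith)
  refine (hP.mul_left ((2 * d + 2 : ℕ) * (d ^ (2 * d + 2) : ℕ) : ℝ)).of_nonneg_of_le
    (fun p => tsum_nonneg fun _ => norm_nonneg _) fun p => ?_
  have hx := norm_prime_cpow_neg_lt_one p.2 (s := s) (by linarith)
  rw [tsum_eq_sum (s := range (2 * d + 2)) fun k hk => by
    rw [term_charCountCoeff_prime_pow d s p.2,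
      numPrimitiveCharOrderDvd_prime_pow_eq_zero_of_le hd p.2
        (by rw [Finset.mem_range] at hk; omega), Nat.cast_zero, zero_mul, norm_zero]]
  rw [mul_assoc, ← nsmul_eq_mul]
  nth_rewrite 2 [← Finset.card_range (2 * d + 2)]
  refine Finset.sum_le_card_nsmul _ _ _ fun k _ => ?_
  rw [term_charCountCoeff_prime_pow d s p.2, norm_mul, Complex.norm_natCast, norm_pow,
    ← norm_prime_cpow_neg p.2 s]
  gcongr
  · exact numPrimitiveCharOrderDvd_prime_pow_le hd p.2 _
  · exact pow_le_of_le_one (norm_nonneg _) hx.le (Nat.succ_ne_zero k)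

lemma hasProd_charCountEulerFactor {d : ℕ} (hd : d ≠ 0) {s : ℂ} (hs : 1 < s.re) :
    HasProd (fun p : Nat.Primes => charCountEulerFactor d p s) (LSeries (charCountCoeff d) s) := by
  have := EulerProduct.eulerProduct_hasProd (term_charCountCoeff_one d s)
    (term_charCountCoeff_mul d s) (summable_norm_term_charCountCoeff hd hs) (by simp)
  exact this.congr_fun fun p => (hasSum_charCountEulerFactor hd s p.2).tsum_eq.symm

/-! ### Comparison with a product of Dirichlet `L`-functions -/

/-- The characters whose `L`-functions approximate the counting series: all Dirichlet characters
modulo `e`, for `e` running over the divisors of `d` other than `1`. -/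
abbrev CharIndex (d : ℕ) : Type :=
  Σ e : {e // e ∈ d.divisors.erase 1}, DirichletCharacter ℂ e

instance (d : ℕ) (e : {e // e ∈ d.divisors.erase 1}) : NeZero (e : ℕ) :=
  ⟨(Nat.pos_of_mem_divisors (Finset.mem_of_mem_erase e.2)).ne'⟩

/-- The Euler factor at `p` of the quotient of the counting series by the product of the
`L`-functions indexed by `CharIndex d`. -/
noncomputable def charCountCorrection (d p : ℕ) (s : ℂ) : ℂ :=
  charCountEulerFactor d p s * ∏ i : CharIndex d, (1 - i.2 p * (p : ℂ) ^ (-s))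

lemma norm_prod_one_sub_sub_le {ι : Type*} (S : Finset ι) {z : ι → ℂ} (hz : ∀ i, ‖z i‖ ≤ 1)
    {x : ℂ} (hx : ‖x‖ ≤ 1) :
    ‖∏ i ∈ S, (1 - z i * x) - (1 - (∑ i ∈ S, z i) * x)‖ ≤ 4 ^ S.card * ‖x‖ ^ 2 := by
  classical
  induction S using Finset.induction_on with
  | empty => simp
  | insert i S hi ih =>
    rw [Finset.prod_insert hi, Finset.sum_insert hi, Finset.card_insert_of_notMem hi]
    have hsum : ‖∑ i ∈ S, z i‖ ≤ S.card := by
      simpa using norm_sum_le_of_le S (fun i _ => hz i)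
    have hcard : (S.card : ℝ) ≤ 4 ^ S.card := by
      exact_mod_cast (Nat.lt_pow_self (by norm_num : 1 < 4)).le
    have hfac : ‖1 - z i * x‖ ≤ 2 := by
      calc ‖1 - z i * x‖ ≤ ‖(1 : ℂ)‖ + ‖z i‖ * ‖x‖ := by
            rw [← norm_mul]; exact norm_sub_le _ _
        _ ≤ 1 + 1 * 1 := by rw [norm_one]; gcongr; exact hz i
        _ = 2 := by norm_num
    set E := ∏ i ∈ S, (1 - z i * x) - (1 - (∑ i ∈ S, z i) * x) with hE
    have : (1 - z i * x) * ∏ i ∈ S, (1 - z i * x) - (1 - (z i + ∑ i ∈ S, z i) * x) =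
        (1 - z i * x) * E + z i * (∑ i ∈ S, z i) * x ^ 2 := by rw [hE]; ring
    rw [this]
    calc _ ≤ ‖1 - z i * x‖ * ‖E‖ + ‖z i‖ * ‖∑ i ∈ S, z i‖ * ‖x‖ ^ 2 := by
          refine (norm_add_le _ _).trans ?_
          simp only [norm_mul, norm_pow, le_refl]
      _ ≤ 2 * (4 ^ S.card * ‖x‖ ^ 2) + 1 * 4 ^ S.card * ‖x‖ ^ 2 := by
          gcongr
          · exact hz i
          · exact hsum.trans hcard
      _ ≤ 4 ^ (S.card + 1) * ‖x‖ ^ 2 := by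
          rw [pow_succ (4 : ℝ)]
          linarith [mul_nonneg (pow_nonneg (by norm_num : (0 : ℝ) ≤ 4) S.card) (sq_nonneg ‖x‖)]

/-- The terms of first order in `p ^ (-s)` cancel in the correction factor, because the number of
primitive characters of conductor `p` is the sum of the values at `p` of the characters in
`CharIndex d`. -/
lemma exists_norm_charCountCorrection_sub_one_le {d : ℕ} (hd : d ≠ 0) :
    ∃ C : ℝ, ∀ (p : Nat.Primes) (s : ℂ), 0 < s.re →
      ‖charCountCorrection d p s - 1‖ ≤ C * ((p : ℝ) ^ (-s.re)) ^ 2 := by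
  set B : ℝ := ((d ^ (2 * d + 2) : ℕ) : ℝ) with hB
  set n := Fintype.card (CharIndex d) with hn
  refine ⟨B ^ 2 + (1 + B) * 4 ^ n + (2 * d : ℕ) * B * 2 ^ n, fun p s hs => ?_⟩
  rw [← norm_prime_cpow_neg p.2 s]
  set x : ℂ := (p : ℂ) ^ (-s) with hx
  have hx1 : ‖x‖ ≤ 1 := (norm_prime_cpow_neg_lt_one p.2 hs).le
  set f : ℂ := (numPrimitiveCharOrderDvd d p : ℂ) with hf
  have hfB : ‖f‖ ≤ B := by
    rw [hf, Complex.norm_natCast, hB]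
    have := numPrimitiveCharOrderDvd_prime_pow_le hd p.2 1
    rw [pow_one] at this
    exact_mod_cast this
  set R : ℂ := ∑ k ∈ range (2 * d), numPrimitiveCharOrderDvd d (p ^ (k + 2)) * x ^ k with hR
  have hfac : charCountEulerFactor d p s = 1 + f * x + R * x ^ 2 := by
    have hRx : R * x ^ 2 =
        ∑ k ∈ range (2 * d), numPrimitiveCharOrderDvd d (p ^ (k + 2)) * x ^ (k + 2) := by
      rw [hR, Finset.sum_mul]
      exact Finset.sum_congr rfl fun k _ => by rw [pow_add]; ring
    rw [charCountEulerFactor, Finset.sum_range_succ', Finset.sum_range_succ', hRx]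
    simp only [← hx, zero_add, pow_one, pow_zero, numPrimitiveCharOrderDvd_one, Nat.cast_one,
      mul_one, add_assoc, one_add_one_eq_two, ← hf]
    ring
  have hRB : ‖R‖ ≤ (2 * d : ℕ) * B := by
    have := norm_sum_le_of_le (range (2 * d)) (f := fun k =>
      (numPrimitiveCharOrderDvd d (p ^ (k + 2)) : ℂ) * x ^ k) (n := fun _ => B) fun k _ => by
        rw [norm_mul, Complex.norm_natCast, norm_pow]
        refine (mul_le_of_le_one_right (Nat.cast_nonneg _)
          (pow_le_one₀ (norm_nonneg _) hx1)).trans ?_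
        rw [hB]
        exact_mod_cast numPrimitiveCharOrderDvd_prime_pow_le hd p.2 (k + 2)
    simpa [hR] using this
  have hz (i : CharIndex d) : ‖i.2 (p : ZMod i.1)‖ ≤ 1 := i.2.norm_le_one _
  have hfsum : f = ∑ i : CharIndex d, i.2 (p : ZMod i.1) := by
    rw [Fintype.sum_sigma, hf]
    exact numPrimitiveCharOrderDvd_prime hd p.2
  set P : ℂ := ∏ i : CharIndex d, (1 - i.2 (p : ZMod i.1) * x) with hP
  have hE : ‖P - (1 - f * x)‖ ≤ 4 ^ n * ‖x‖ ^ 2 := by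
    have := norm_prod_one_sub_sub_le (Finset.univ : Finset (CharIndex d)) hz hx1
    rwa [← hfsum] at this
  have hPle : ‖P‖ ≤ 2 ^ n := by
    rw [hP, norm_prod]
    refine (Finset.prod_le_prod (g := fun _ => 2) (fun _ _ => norm_nonneg _) fun i _ => ?_).trans_eq
      (by rw [Finset.prod_const, hn, Finset.card_univ])
    calc ‖1 - i.2 (p : ZMod i.1) * x‖ ≤ ‖(1 : ℂ)‖ + ‖i.2 (p : ZMod i.1)‖ * ‖x‖ := by
          rw [← norm_mul]; exact norm_sub_le _ _
      _ ≤ 1 + 1 * 1 := by rw [norm_one]; gcongr; exact hz i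
      _ = 2 := by norm_num
  have hB0 : 0 ≤ B := Nat.cast_nonneg _
  have key : charCountCorrection d p s - 1 =
      -(f ^ 2 * x ^ 2) + (1 + f * x) * (P - (1 - f * x)) + R * x ^ 2 * P := by
    rw [charCountCorrection, hfac, ← hP]; ring
  rw [key]
  have h1 : ‖1 + f * x‖ ≤ 1 + B := by
    calc ‖1 + f * x‖ ≤ ‖(1 : ℂ)‖ + ‖f‖ * ‖x‖ := by
          rw [← norm_mul]; exact norm_add_le _ _
      _ ≤ 1 + B * 1 := by rw [norm_one]; gcongr
      _ = 1 + B := by ring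
  calc _ ≤ ‖f‖ ^ 2 * ‖x‖ ^ 2 + ‖1 + f * x‖ * ‖P - (1 - f * x)‖ + ‖R‖ * ‖x‖ ^ 2 * ‖P‖ := by
        refine (norm_add₃_le).trans ?_
        simp only [norm_mul, norm_pow, norm_neg, le_refl]
    _ ≤ B ^ 2 * ‖x‖ ^ 2 + (1 + B) * (4 ^ n * ‖x‖ ^ 2) + (2 * d : ℕ) * B * ‖x‖ ^ 2 * 2 ^ n := by
        gcongr
    _ = _ := by ring

lemma charCountCorrection_eq_one_add (d p : ℕ) (s : ℂ) :
    charCountCorrection d p s = 1 + (charCountCorrection d p s - 1) := by ring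

lemma differentiable_charCountCorrection (d : ℕ) (p : Nat.Primes) :
    Differentiable ℂ (charCountCorrection d p) := by
  have hp : ((p : ℕ) : ℂ) ≠ 0 := Nat.cast_ne_zero.2 p.2.ne_zero
  have hx : Differentiable ℂ fun s : ℂ => (p : ℂ) ^ (-s) := fun s =>
    differentiableAt_id.neg.const_cpow (Or.inl hp)
  unfold charCountCorrection charCountEulerFactor
  fun_prop

lemma summable_prime_rpow_sq {σ : ℝ} (hσ : 1 / 2 < σ) :
    Summable fun p : Nat.Primes => ((p : ℝ) ^ (-σ)) ^ 2 := by
  refine (Nat.Primes.summable_rpow.2 (by linarith : -(2 * σ) < -1)).congr fun p => ?_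
  rw [← Real.rpow_natCast, ← Real.rpow_mul (Nat.cast_nonneg _)]
  congr 1
  push_cast
  ring

lemma summable_norm_charCountCorrection_sub_one {d : ℕ} (hd : d ≠ 0) {s : ℂ} (hs : 1 / 2 < s.re) :
    Summable fun p : Nat.Primes => ‖charCountCorrection d p s - 1‖ := by
  obtain ⟨C, hC⟩ := exists_norm_charCountCorrection_sub_one_le hd
  exact ((summable_prime_rpow_sq hs).mul_left C).of_nonneg_of_le (fun _ => norm_nonneg _)
    fun p => hC p s (by linarith)

lemma differentiableOn_tprod_charCountCorrection {d : ℕ} (hd : d ≠ 0) :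
    DifferentiableOn ℂ (fun s => ∏' p : Nat.Primes, charCountCorrection d p s)
      {s | 1 / 2 < s.re} := by
  -- The bound `C * p ^ (-2 * σ)` is uniform only on half planes `σ < re z` with `1 / 2 < σ`.
  intro s hs
  obtain ⟨C, hC⟩ := exists_norm_charCountCorrection_sub_one_le hd
  obtain ⟨σ, hσ, hσs⟩ := exists_between (show 1 / 2 < s.re from hs)
  have hU : IsOpen {z : ℂ | σ < z.re} := isOpen_lt continuous_const Complex.continuous_re
  have hC0 : 0 ≤ C := by
    have := (norm_nonneg _).trans (hC ⟨2, Nat.prime_two⟩ 1 (by simp))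
    exact nonneg_of_mul_nonneg_left this (by positivity)
  have hprod := ((summable_prime_rpow_sq hσ).mul_left C).hasProdLocallyUniformlyOn_one_add
    (f := fun (p : Nat.Primes) z => charCountCorrection d p z - 1) hU
    (Filter.Eventually.of_forall fun p z hz => ?_)
    (fun p => ((differentiable_charCountCorrection d p).sub_const 1).continuous.continuousOn)
  · have hdiff : DifferentiableOn ℂ
        (fun z => ∏' p : Nat.Primes, (1 + (charCountCorrection d p z - 1)))
        {z : ℂ | σ < z.re} := by
      refine hprod.differentiableOn (Filter.Eventually.of_forall fun S => ?_) hU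
      have := fun p : Nat.Primes => differentiable_charCountCorrection d p
      fun_prop
    simp only [add_sub_cancel] at hdiff
    exact (hdiff.differentiableAt (hU.mem_nhds hσs)).differentiableWithinAt
  · refine (hC p z (by linarith [show σ < z.re from hz])).trans ?_
    have : (1 : ℝ) ≤ p := by exact_mod_cast p.2.one_le
    gcongr
    exact le_of_lt hz

lemma one_sub_char_mul_cpow_ne_zero {N : ℕ} (χ : DirichletCharacter ℂ N) {p : ℕ} (hp : p.Prime)
    {s : ℂ} (hs : 0 < s.re) : 1 - χ p * (p : ℂ) ^ (-s) ≠ 0 := by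
  intro h
  have h1 : ‖χ p * (p : ℂ) ^ (-s)‖ = 1 := by rw [← sub_eq_zero.1 h, norm_one]
  rw [norm_mul] at h1
  have := mul_le_of_le_one_left (norm_nonneg ((p : ℂ) ^ (-s))) (χ.norm_le_one (p : ZMod N))
  linarith [norm_prime_cpow_neg_lt_one hp hs]

lemma charCountCorrection_one_ne_zero (d : ℕ) {p : ℕ} (hp : p.Prime) :
    charCountCorrection d p 1 ≠ 0 := by
  refine mul_ne_zero ?_ (Finset.prod_ne_zero_iff.2 fun i _ =>
    one_sub_char_mul_cpow_ne_zero i.2 hp (by simp))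
  -- At `s = 1` the Euler factor is a sum of nonnegative reals with first term `1`.
  have : charCountEulerFactor d p 1 =
      ((∑ k ∈ range (2 * d + 2),
        numPrimitiveCharOrderDvd d (p ^ k) * ((p : ℝ)⁻¹) ^ k : ℝ) : ℂ) := by
    simp [charCountEulerFactor, Complex.cpow_neg]
  rw [this, Complex.ofReal_ne_zero, Finset.sum_range_succ', pow_zero,
    numPrimitiveCharOrderDvd_one]
  positivity

lemma tprod_charCountCorrection_one_ne_zero {d : ℕ} (hd : d ≠ 0) :
    ∏' p : Nat.Primes, charCountCorrection d p 1 ≠ 0 := by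
  rw [tprod_congr fun p : Nat.Primes => charCountCorrection_eq_one_add d p 1]
  refine tprod_one_add_ne_zero_of_summable (fun p => ?_)
    (summable_norm_charCountCorrection_sub_one hd (by norm_num))
  rw [← charCountCorrection_eq_one_add]
  exact charCountCorrection_one_ne_zero d p.2

lemma LSeries_charCountCoeff_eq {d : ℕ} (hd : d ≠ 0) {s : ℂ} (hs : 1 < s.re) :
    LSeries (charCountCoeff d) s = (∏' p : Nat.Primes, charCountCorrection d p s) *
      ∏ i : CharIndex d, DirichletCharacter.LFunction i.2 s := by
  have h1 : HasProd (fun p : Nat.Primes => charCountCorrection d p s)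
      (∏' p : Nat.Primes, charCountCorrection d p s) := by
    refine Multipliable.hasProd ?_
    simpa only [add_sub_cancel] using multipliable_one_add_of_summable
      (summable_norm_charCountCorrection_sub_one hd (by linarith : 1 / 2 < s.re))
  have h2 : HasProd (fun p : Nat.Primes =>
      ∏ i : CharIndex d, (1 - i.2 (p : ZMod i.1) * (p : ℂ) ^ (-s))⁻¹)
      (∏ i : CharIndex d, DirichletCharacter.LFunction i.2 s) := by
    refine hasProd_prod fun i _ => ?_
    rw [DirichletCharacter.LFunction_eq_LSeries _ hs]
    exact DirichletCharacter.LSeries_eulerProduct_hasProd i.2 hs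
  refine (hasProd_charCountEulerFactor hd hs).unique ((h1.mul h2).congr_fun fun p => ?_)
  rw [charCountCorrection, mul_assoc, ← Finset.prod_mul_distrib, Finset.prod_eq_one, mul_one]
  exact fun i _ => mul_inv_cancel₀ (one_sub_char_mul_cpow_ne_zero i.2 p.2 (by linarith))

/-! ### The order of the pole -/

namespace DirichletCharacter

lemma meromorphicOrderAt_LFunction_one_of_ne_one {N : ℕ} [NeZero N] {χ : DirichletCharacter ℂ N}
    (hχ : χ ≠ 1) : meromorphicOrderAt (LFunction χ) 1 = 0 := by
  have ha : AnalyticAt ℂ (LFunction χ) 1 := (differentiable_LFunction hχ).analyticAt 1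
  rw [ha.meromorphicOrderAt_eq, ha.analyticOrderAt_eq_zero.2 (LFunction_apply_one_ne_zero hχ)]
  rfl

lemma LFunctionTrivChar_eq_zpow_smul {N : ℕ} [NeZero N] {s : ℂ} (hs : s ≠ 1) :
    LFunctionTrivChar N s = (s - 1) ^ (-1 : ℤ) • LFunctionTrivChar₁ N s := by
  rw [LFunctionTrivChar₁, Function.update_of_ne hs, zpow_neg_one, smul_eq_mul,
    inv_mul_cancel_left₀ (sub_ne_zero.2 hs)]

open Filter Topology in
lemma meromorphicAt_LFunction {N : ℕ} [NeZero N] (χ : DirichletCharacter ℂ N) (s : ℂ) :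
    MeromorphicAt (LFunction χ) s := by
  rcases eq_or_ne χ 1 with rfl | hχ
  · rcases eq_or_ne s 1 with rfl | hs
    · have h : MeromorphicAt (fun z : ℂ => (z - 1) ^ (-1 : ℤ) • LFunctionTrivChar₁ N z) 1 :=
        (((MeromorphicAt.id 1).sub (MeromorphicAt.const 1 1)).zpow (-1)).smul
          ((differentiable_LFunctionTrivChar₁ N).analyticAt 1).meromorphicAt
      refine h.congr ?_
      filter_upwards [self_mem_nhdsWithin] with z hz
      exact (LFunctionTrivChar_eq_zpow_smul hz).symm
    · have hd : DifferentiableOn ℂ (LFunction (1 : DirichletCharacter ℂ N)) {1}ᶜ := fun z hz =>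
        (differentiableAt_LFunction 1 z (Or.inl hz)).differentiableWithinAt
      exact (hd.analyticAt (isOpen_compl_singleton.mem_nhds hs)).meromorphicAt
  · exact ((differentiable_LFunction hχ).analyticAt s).meromorphicAt

open Filter Topology in
lemma meromorphicOrderAt_LFunctionTrivChar_one (N : ℕ) [NeZero N] :
    meromorphicOrderAt (LFunctionTrivChar N) 1 = (-1 : ℤ) := by
  refine (meromorphicOrderAt_eq_int_iff (meromorphicAt_LFunction 1 1)).2
    ⟨LFunctionTrivChar₁ N, (differentiable_LFunctionTrivChar₁ N).analyticAt 1,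
      LFunctionTrivChar₁_apply_one_ne_zero N, ?_⟩
  filter_upwards [self_mem_nhdsWithin] with z hz
  exact LFunctionTrivChar_eq_zpow_smul hz

end DirichletCharacter

/-- Each divisor `e ≠ 1` of `d` contributes one simple pole, from the trivial character modulo `e`;
the other `L`-functions are finite and nonzero at `1`. -/
lemma meromorphicOrderAt_prod_LFunction_one {d : ℕ} (hd : d ≠ 0) :
    meromorphicOrderAt (fun s => ∏ i : CharIndex d, DirichletCharacter.LFunction i.2 s) 1 =
      ((-((d.divisors.card : ℤ) - 1) : ℤ) : WithTop ℤ) := by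
  classical
  have h (i : CharIndex d) : meromorphicOrderAt (DirichletCharacter.LFunction i.2) 1 =
      ((if i.2 = 1 then -1 else 0 : ℤ) : WithTop ℤ) := by
    split_ifs with hi
    · rw [hi]
      exact DirichletCharacter.meromorphicOrderAt_LFunctionTrivChar_one i.1
    · exact DirichletCharacter.meromorphicOrderAt_LFunction_one_of_ne_one hi
  rw [meromorphicOrderAt_fun_prod fun i _ => DirichletCharacter.meromorphicAt_LFunction i.2 1,
    Finset.sum_congr rfl fun i _ => h i, ← WithTop.coe_sum, Fintype.sum_sigma]
  have h1 : (1 : ℕ) ∈ d.divisors := by simp [hd]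
  have hcard : 1 ≤ d.divisors.card := Finset.card_pos.2 ⟨1, h1⟩
  have hinner (e : {e // e ∈ d.divisors.erase 1}) :
      ∑ χ : DirichletCharacter ℂ e, (if χ = 1 then -1 else 0 : ℤ) = -1 := by
    rw [Finset.sum_eq_single 1 (fun χ _ hχ => if_neg hχ) (by simp), if_pos rfl]
  rw [Finset.sum_congr rfl fun e _ => hinner e, Finset.sum_const, Finset.card_univ,
    Fintype.card_coe, Finset.card_erase_of_mem h1, nsmul_eq_mul, Nat.cast_sub hcard]
  congr 1
  ring

theorem mainTheorem3 (d : ℕ) (hd : 1 ≤ d) :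
    (∀ s : ℂ, 1 < s.re → LSeriesSummable (charCountCoeff d) s) ∧
    ∃ G : ℂ → ℂ,
      MeromorphicOn G {s : ℂ | 1 / 2 < s.re} ∧
      (∀ s : ℂ, 1 < s.re → G s = LSeries (charCountCoeff d) s) ∧
      meromorphicOrderAt G 1 = ((-((d.divisors.card : ℤ) - 1) : ℤ) : WithTop ℤ) := by
  have hd0 : d ≠ 0 := by omega
  have hU : IsOpen {s : ℂ | 1 / 2 < s.re} := isOpen_lt continuous_const Complex.continuous_re
  have hH (s : ℂ) (hs : 1 / 2 < s.re) :
      AnalyticAt ℂ (fun s => ∏' p : Nat.Primes, charCountCorrection d p s) s :=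
    (differentiableOn_tprod_charCountCorrection hd0).analyticAt (hU.mem_nhds hs)
  have hL (s : ℂ) : MeromorphicAt
      (fun s => ∏ i : CharIndex d, DirichletCharacter.LFunction i.2 s) s :=
    MeromorphicAt.fun_prod fun i _ => DirichletCharacter.meromorphicAt_LFunction i.2 s
  refine ⟨fun s hs => (summable_norm_term_charCountCoeff hd0 hs).of_norm,
    (fun s => ∏' p : Nat.Primes, charCountCorrection d p s) *
      fun s => ∏ i : CharIndex d, DirichletCharacter.LFunction i.2 s,
    fun s hs => (hH s hs).meromorphicAt.mul (hL s),
    fun s hs => (LSeries_charCountCoeff_eq hd0 hs).symm, ?_⟩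
  rw [meromorphicOrderAt_mul_of_ne_zero (hH 1 (by norm_num))
    (tprod_charCountCorrection_one_ne_zero hd0), meromorphicOrderAt_prod_LFunction_one hd0]
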